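/- Let $k\ge 1$ and $n>k$ be integers. **Instances.** Type distributions $\mathbf G$ for $n$ agents consist of an integer $m$ (the number of types) and probability vectors $(p_{ij})_{j=1}^m$, $i=1,\dots,n$; put $G_{ij}=\sum_{j'\le j}p_{ij'}$ for $0\le j\le m$, so that $0=G_{i0}\le G_{i1}\le\cdots\le G_{im}=1$. An instance $I\in\mathcal I_{k,n}$ consists of type distributions $\mathbf G$ and valuations $r_1\ge\cdots\ge r_m\ge0$. Agents $i=1,\dots,n$ arrive in this order and have independent types, agent $i$ having type $j$ (and then valuation $R_i=r_j$) with probability $p_{ij}$. At most $k$ agents can be accepted. **Policies and benchmarks.** For $J\in[m]$ and $\rho\in(0,1]$, the static threshold policy $(J,\rho)$ accepts the first $k$ agents to arrive that qualify, where an agent qualifies if its type is $<J$, or if its type is $J$ and an independent coin of success probability $\rho$ succeeds. Let $\mathsf{ST}(I)$ be the supremum over $(J,\rho)$, which may depend on the whole instance $I$, of the expected total valuation of the accepted agents. Let $$\mathsf{Proph}(I)=\mathbb E\Big[\max_{S\subseteq[n],|S|\le k}\sum_{i\in S}R_i\Big],\qquad \mathsf{ExAnte}(I)=\max\Big\{\sum_{j=1}^m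 r_ja_j:\ \sum_{j=1}^m a_j\le k,\ 0\le a_j\le\sum_{i=1}^n p_{ij}\ \forall j\Big\}.$$ **Dual LP.** Let $\mathcal P^k_n$ be the set of real vectors $(x^l_i,y^l_i)_{i\in[n],l\in[k]}$ such that $0\le y^l_i\le x^l_i$ for all $i,l$, $x^k_1=1$, $x^l_1=0$ for $l<k$, and $x^l_i=x^l_{i-1}-y^l_{i-1}+y^{l+1}_{i-1}$ for $i>1$, where $y^{k+1}_{i}:=0$. Given $\mathbf G$ and coefficients $Q_1,\dots,Q_m$, consider the problem of maximizing $\theta\in\mathbb R$ over all probability measures $\mu$ on $[m]\times(0,1]$ and all families $(\mathbf x(J,\rho),\mathbf y(J,\rho))\in\mathcal P^k_n$, $J\in[m]$, $\rho\in(0,1]$, subject to $$y^l_i(J,\rho)=\big((1-\rho)G_{i,J-1}+\rho G_{iJ}\big)x^l_i(J,\rho)\qquad\forall i\in[n],\,l\in[k],\,J\in[m],\,\rho\in(0,1],$$ $$\theta\, Q_j\le\int\sum_{i=1}^n\sum_{l=1}^k\min\{y^l_i(J,\rho),\,G_{ij}x^l_i(J,\rho)\}\,d\mu(J,\rho)\qquad\forall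 j\in[m].$$ Let $\mathrm{innerLP}^{\mathsf{ST}/\mathsf{Proph}}_{k,n}(\mathbf G)$, resp. $\mathrm{innerLP}^{\mathsf{ST}/\mathsf{ExAnte}}_{k,n}(\mathbf G)$, be its optimal value (the supremum of the feasible $\theta$) for $Q_j=\mathbb E[\min\{\sum_{i=1}^n\mathrm{Ber}(G_{ij}),k\}]$ with independent Bernoulli variables, resp. $Q_j=\min\{\sum_{i=1}^nG_{ij},k\}$. **Theorem.** For all integers $k\ge1$ and $n>k$, $$\inf_{I}\frac{\mathsf{ST}(I)}{\mathsf{Proph}(I)}=\inf_{\mathbf G}\ \mathrm{innerLP}^{\mathsf{ST}/\mathsf{Proph}}_{k,n}(\mathbf G)\qquad\text{and}\qquad\inf_{I}\frac{\mathsf{ST}(I)}{\mathsf{ExAnte}(I)}=\inf_{\mathbf G}\ \mathrm{innerLP}^{\mathsf{ST}/\mathsf{ExAnte}}_{k,n}(\mathbf G),$$ where the infima on the left are over all instances $I\in\mathcal I_{k,n}$ whose benchmark $\mathsf{Proph}(I)$, resp. $\mathsf{ExAnte}(I)$, is positive, and those on the right are over all type distributions $\mathbf G$ of $n$ agents. 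-/

import Mathlib

open scoped BigOperators

noncomputable section

namespace StaticThreshold

/-- Expectation of `f b`, where the `b i` are independent Bernoulli variables and `b i` is
`true` with probability `q i`. -/
def berExpect {n : ℕ} (q : Fin n → ℝ) (f : (Fin n → Bool) → ℝ) : ℝ :=
  ∑ b : Fin n → Bool, (∏ i, if b i then q i else 1 - q i) * f b

/-- Type distributions of `n` agents: a number `m` of types and, for each agent `i`, a
probability vector `p i` over the types. The types `1, …, m` are the elements of `Fin m`
in increasing order, so that smaller types are better. -/
structure TypeDist (n : ℕ) where
  m : ℕ
  p : Fin n → Fin m → ℝ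
  p_nonneg : ∀ i j, 0 ≤ p i j
  p_sum : ∀ i, ∑ j, p i j = 1

namespace TypeDist

variable {n : ℕ} (D : TypeDist n)

/-- `D.G i j` is the probability that agent `i` has one of the `j` best types, for
`j = 0, …, m`. Since `Fin m` starts at `0`, the probability that agent `i` has type
`j : Fin m` or better is `D.G i (j + 1)`, and a type strictly better than `j` is `D.G i j`. -/
def G (i : Fin n) (j : ℕ) : ℝ := ∑ j' : Fin D.m with j'.val < j, D.p i j'

/-- Expectation of `f t`, where the types `t i` of the agents are drawn independently. -/
def expect (f : (Fin n → Fin D.m) → ℝ) : ℝ :=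
  ∑ t : Fin n → Fin D.m, (∏ i, D.p i (t i)) * f t

/-- The parameters `(J, ρ)` of a static threshold policy: a type `J` and a tie-break
probability `ρ ∈ (0, 1]`. -/
abbrev Threshold : Type := Fin D.m × Set.Ioc (0 : ℝ) 1

/-- `Q_j` for the prophet: `E[min (∑ i, Ber (G_ij)) k]`. -/
def prophQ (k : ℕ) (j : Fin D.m) : ℝ :=
  berExpect (fun i => D.G i (j + 1))
    fun b => min ((Finset.univ.filter fun i => b i = true).card : ℝ) (k : ℝ)

/-- `Q_j` for the ex-ante relaxation: `min (∑ i, G_ij) k`. -/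
def exAnteQ (k : ℕ) (j : Fin D.m) : ℝ := min (∑ i, D.G i (j + 1)) (k : ℝ)

end TypeDist

/-- An instance with `n` agents: type distributions together with the valuations
`r 1 ≥ ⋯ ≥ r m ≥ 0` of the types. (The number `k` of slots is a separate argument below.) -/
structure ProphetInstance (n : ℕ) extends TypeDist n where
  r : Fin m → ℝ
  r_antitone : Antitone r
  r_nonneg : ∀ j, 0 ≤ r j

namespace ProphetInstance

variable {n : ℕ} (I : ProphetInstance n)

/-- The prophet's performance: the expected maximum total valuation of at most `k` agents. -/
def proph (k : ℕ) : ℝ :=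
  I.expect fun t =>
    (Finset.univ.filter fun S : Finset (Fin n) => S.card ≤ k).sup' ⟨∅, by simp⟩
      fun S => ∑ i ∈ S, I.r (t i)

/-- The ex-ante relaxation: the value of the linear program that maximizes `∑ j, r j * a j`
subject to `∑ j, a j ≤ k` and `0 ≤ a j ≤ ∑ i, p i j`. -/
def exAnte (k : ℕ) : ℝ :=
  sSup {v : ℝ | ∃ a : Fin I.m → ℝ, ∑ j, a j ≤ k ∧
    (∀ j, 0 ≤ a j ∧ a j ≤ ∑ i, I.p i j) ∧ v = ∑ j, I.r j * a j}

/-- Agent `i` qualifies for the static threshold `J`, given the realized types `t` and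
tie-break coins `c`: its type is better than `J`, or equal to `J` with a successful coin. -/
abbrev Qualifies (J : Fin I.m) (t : Fin n → Fin I.m) (c : Fin n → Bool) (i : Fin n) : Prop :=
  t i < J ∨ (t i = J ∧ c i = true)

/-- Expected total valuation collected by the static threshold policy `(J, ρ)`, which accepts
the first `k` agents that qualify: agent `i` is accepted if and only if it qualifies and fewer
than `k` earlier agents qualified. The coins are independent, with success probability `ρ`. -/
def policyValue (k : ℕ) (a : I.Threshold) : ℝ :=
  I.expect fun t => berExpect (fun _ => (a.2 : ℝ)) fun c =>
    ∑ i, if I.Qualifies a.1 t c i ∧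
        (Finset.univ.filter fun i' => i' < i ∧ I.Qualifies a.1 t c i').card < k
      then I.r (t i) else 0

/-- `ST(I)`: the performance of the best static threshold policy for the instance. -/
def st (k : ℕ) : ℝ := ⨆ a : I.Threshold, I.policyValue k a

end ProphetInstance

/-- The polytope `P^k_n` of state-updating constraints. The index `l : Fin k` stands for
`l + 1` remaining slots; `y` with `k + 1` remaining slots is understood to be `0`. -/
structure StatePolytope {n k : ℕ} (x y : Fin n → Fin k → ℝ) : Prop where
  y_le : ∀ i l, y i l ≤ x i l
  init : ∀ (i : Fin n) (l : Fin k), i.val = 0 → x i l = if l.val + 1 = k then 1 else 0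
  step : ∀ (i : Fin n) (hi : i.val + 1 < n) (l : Fin k),
    x ⟨i.val + 1, hi⟩ l =
      x i l - y i l + (if hl : l.val + 1 < k then y i ⟨l.val + 1, hl⟩ else 0)
  y_nonneg : ∀ i l, 0 ≤ y i l

/-- Feasible solutions `(θ, μ, x, y)` of the dual linear program for static thresholds, with
coefficients `Q j`: `μ` is a probability measure over the thresholds `(J, ρ)`. -/
structure DualFeasible {n : ℕ} (k : ℕ) (D : TypeDist n) (Q : Fin D.m → ℝ) (θ : ℝ)
    (μ : MeasureTheory.Measure D.Threshold)
    (x y : D.Threshold → Fin n → Fin k → ℝ) : Prop where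
  cover : ∀ j : Fin D.m,
    θ * Q j ≤ ∫ a, (∑ i, ∑ l, min (y a i l) (D.G i (j + 1) * x a i l)) ∂μ
  rule : ∀ (a : D.Threshold) (i : Fin n) (l : Fin k),
    y a i l = ((1 - (a.2 : ℝ)) * D.G i a.1 + (a.2 : ℝ) * D.G i (a.1 + 1)) * x a i l
  state : ∀ a : D.Threshold, StatePolytope (x a) (y a)
  prob : MeasureTheory.IsProbabilityMeasure μ

/-- The optimal value of the dual linear program for static thresholds. -/
def innerLP {n : ℕ} (k : ℕ) (D : TypeDist n) (Q : Fin D.m → ℝ) : EReal :=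
  sSup {v : EReal | ∃ (θ : ℝ) (μ : MeasureTheory.Measure D.Threshold)
    (x y : D.Threshold → Fin n → Fin k → ℝ), DualFeasible k D Q θ μ x y ∧ v = (θ : EReal)}

end StaticThreshold

end

/-! Fix the type distributions and write nonincreasing valuations as tail sums of increments `δ j ≥
0`. Every quantity then becomes linear in `δ`: the benchmarks are `∑ j, δ j * Q j` (`proph_eq`,
`exAnte_eq`), and the policy `a` earns `∑ j, δ j * D.accepted k j a` (`policyValue_eq`), where
`accepted` counts the accepted agents of type `j` or better. The worst ratio over valuations is thus
the value of a zero-sum game between `δ` and the threshold.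

On the LP side, the rule `y = q * x` makes the state recursion deterministic, so `x` must be the law
of the number of free slots (`StatePolytope.eq_slotProb`) and the covering integrand is exactly
`accepted`. The LP is therefore the same game played with a mixed threshold `μ`.

Weak duality is integration against `μ` (`DualFeasible.mul_le_iSup`). Strong duality separates `θ •
Q` from the closed convex set of vectors dominated by mixed policies (`mem_closure_dominatedSet`).
Since `ρ` ranges over the non-compact `(0, 1]`, attainment is avoided: an arbitrarily small loss in
`θ` passes from the closure to an actual measure (`exists_dualFeasible_of_lt`). -/

noncomputable section

namespace StaticThreshold

/-! ### Finite expectations over independent coordinates. -/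

section PiExpect

variable {n : ℕ} {α β : Type*} [Fintype α] [Fintype β]

/-- Expectation of `f t`, where the coordinates `t i` are independent with weights `w i`. -/
def piExpect (w : Fin n → α → ℝ) (f : (Fin n → α) → ℝ) : ℝ :=
  ∑ t : Fin n → α, (∏ i, w i (t i)) * f t

lemma piExpect_nonneg {w : Fin n → α → ℝ} (hw : ∀ i z, 0 ≤ w i z) {f : (Fin n → α) → ℝ}
    (hf : ∀ t, 0 ≤ f t) : 0 ≤ piExpect w f :=
  Finset.sum_nonneg fun t _ => mul_nonneg (Finset.prod_nonneg fun i _ => hw i _) (hf t)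

lemma piExpect_sum {κ : Type*} (s : Finset κ) (w : Fin n → α → ℝ)
    (f : κ → (Fin n → α) → ℝ) :
    piExpect w (fun t => ∑ c ∈ s, f c t) = ∑ c ∈ s, piExpect w (f c) := by
  simp only [piExpect, Finset.mul_sum]
  exact Finset.sum_comm

lemma piExpect_add (w : Fin n → α → ℝ) (f g : (Fin n → α) → ℝ) :
    piExpect w (fun t => f t + g t) = piExpect w f + piExpect w g := by
  simp only [piExpect, mul_add, Finset.sum_add_distrib]

lemma piExpect_const_mul (w : Fin n → α → ℝ) (c : ℝ) (f : (Fin n → α) → ℝ) :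
    piExpect w (fun t => c * f t) = c * piExpect w f := by
  simp only [piExpect, Finset.mul_sum]
  exact Finset.sum_congr rfl fun t _ => by ring

lemma piExpect_one {w : Fin n → α → ℝ} (hw : ∀ i, ∑ z, w i z = 1) :
    piExpect w (fun _ => 1) = 1 := by
  classical
  have h := Finset.prod_univ_sum (fun _ : Fin n => (Finset.univ : Finset α)) w
  simp only [hw, Finset.prod_const_one, Fintype.piFinset_univ] at h
  simp [piExpect, ← h]

lemma piExpect_mono {w : Fin n → α → ℝ} (hw : ∀ i z, 0 ≤ w i z) {f g : (Fin n → α) → ℝ}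
    (hfg : ∀ t, f t ≤ g t) : piExpect w f ≤ piExpect w g :=
  Finset.sum_le_sum fun t _ =>
    mul_le_mul_of_nonneg_left (hfg t) (Finset.prod_nonneg fun i _ => hw i _)

lemma piExpect_map [DecidableEq β] (w : Fin n → α → ℝ) (g : α → β) (f : (Fin n → β) → ℝ) :
    piExpect w (fun t => f fun i => g (t i)) =
      piExpect (fun i b => ∑ z with g z = b, w i z) f := by
  classical
  simp only [piExpect]
  rw [← Finset.sum_fiberwise (Finset.univ : Finset (Fin n → α)) (fun t i => g (t i))]
  refine Finset.sum_congr rfl fun b _ => ?_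
  rw [Finset.prod_univ_sum, Finset.sum_mul]
  refine Finset.sum_congr ?_ ?_
  · ext t
    simp [Fintype.mem_piFinset, funext_iff]
  · intro t ht
    have : (fun i => g (t i)) = b := by
      funext i
      simpa using (Fintype.mem_piFinset.mp ht) i
    rw [this]

lemma piExpect_pair (w : Fin n → α → ℝ) (v : Fin n → β → ℝ)
    (f : (Fin n → α) → (Fin n → β) → ℝ) :
    piExpect w (fun t => piExpect v fun c => f t c) =
      piExpect (fun i (z : α × β) => w i z.1 * v i z.2)
        (fun z => f (fun i => (z i).1) fun i => (z i).2) := by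
  simp only [piExpect, Finset.mul_sum]
  rw [← Fintype.sum_prod_type' (fun t c =>
    (∏ i, w i (t i)) * ((∏ i, v i (c i)) * f t c))]
  refine (Fintype.sum_equiv (Equiv.arrowProdEquivProdArrow (Fin n) (fun _ => α) (fun _ => β))
    _ _ fun z => ?_).symm
  simp only [Equiv.arrowProdEquivProdArrow, Equiv.coe_fn_mk, Finset.prod_mul_distrib]
  ring

/-- Independence: `f` ignores coordinate `i`, so that coordinate can be summed out separately. -/
lemma piExpect_mul_of_indep {w : Fin n → α → ℝ} (i : Fin n) (hw : ∑ z, w i z = 1)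
    (g : α → ℝ) (f : (Fin n → α) → ℝ)
    (hf : ∀ t t', (∀ i', i' ≠ i → t i' = t' i') → f t = f t') :
    piExpect w (fun t => g (t i) * f t) = (∑ z, w i z * g z) * piExpect w f := by
  obtain _ | n := n
  · exact i.elim0
  rcases isEmpty_or_nonempty α with h | ⟨⟨z₀⟩⟩
  · simp at hw
  have key : ∀ h : α → ℝ, piExpect w (fun t => h (t i) * f t) =
      (∑ z, w i z * h z) *
        ∑ t : Fin n → α, (∏ i', w (i.succAbove i') (t i')) * f (i.insertNth z₀ t) := by
    intro h
    simp only [piExpect]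
    rw [← (Fin.insertNthEquiv (fun _ => α) i).sum_comp, Fintype.sum_prod_type, Finset.sum_mul]
    refine Finset.sum_congr rfl fun z _ => ?_
    rw [Finset.mul_sum]
    refine Finset.sum_congr rfl fun t _ => ?_
    have : f (i.insertNth z t) = f (i.insertNth z₀ t) := by
      apply hf
      intro i' hi'
      obtain ⟨i'', rfl⟩ := Fin.exists_succAbove_eq hi'
      simp
    rw [Fin.prod_univ_succAbove _ i]
    simp only [Fin.insertNthEquiv_apply, Fin.insertNth_apply_same,
      Fin.insertNth_apply_succAbove]
    change _ * (h z * f (i.insertNth z t)) = _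
    rw [this]
    ring
  have h1 := key fun _ => 1
  simp only [one_mul, mul_one, hw] at h1
  rw [key g]
  congr 1
  exact h1.symm

end PiExpect

/-! ### The law of the number of free slots. -/

section Bernoulli

variable {n : ℕ}

/-- The weights of a Bernoulli variable with success probability `q i`. -/
def berWeight (q : Fin n → ℝ) (i : Fin n) (b : Bool) : ℝ := if b then q i else 1 - q i

lemma berExpect_eq_piExpect (q : Fin n → ℝ) (f : (Fin n → Bool) → ℝ) :
    berExpect q f = piExpect (berWeight q) f := rfl

lemma berWeight_sum (q : Fin n → ℝ) (i : Fin n) : ∑ b, berWeight q i b = 1 := by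
  simp [berWeight]

lemma berWeight_nonneg {q : Fin n → ℝ} (h0 : ∀ i, 0 ≤ q i) (h1 : ∀ i, q i ≤ 1) (i : Fin n)
    (b : Bool) : 0 ≤ berWeight q i b := by
  cases b
  · simpa [berWeight] using h1 i
  · simpa [berWeight] using h0 i

lemma fiber_sum_eq_berWeight {α : Type*} [Fintype α] {w : Fin n → α → ℝ}
    (hw : ∀ i, ∑ z, w i z = 1) (g : α → Bool) :
    (fun i b => ∑ z with g z = b, w i z) = berWeight fun i => ∑ z with g z = true, w i z := by
  funext i b
  cases b
  · have := Finset.sum_filter_add_sum_filter_not Finset.univ (fun z => g z = true) (w i)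
    rw [hw] at this
    simp only [Bool.not_eq_true] at this
    simp only [berWeight, Bool.false_eq_true, if_false]
    linarith
  · simp [berWeight]

/-- The number of successes before position `i`. -/
def priorCount (b : Fin n → Bool) (i : Fin n) : ℕ :=
  (Finset.univ.filter fun i' => i' < i ∧ b i' = true).card

lemma priorCount_congr {b b' : Fin n → Bool} {i : Fin n} (h : ∀ i', i' ≠ i → b i' = b' i') :
    priorCount b i = priorCount b' i := by
  unfold priorCount
  congr 1
  ext i'
  simp only [Finset.mem_filter, Finset.mem_univ, true_and]
  refine and_congr_right fun hlt => ?_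
  rw [h i' hlt.ne]

lemma priorCount_zero (b : Fin n → Bool) {i : Fin n} (hi : i.val = 0) : priorCount b i = 0 := by
  simp only [priorCount, Finset.card_eq_zero, Finset.filter_eq_empty_iff]
  rintro i' - ⟨h, -⟩
  exact absurd (Fin.lt_def.mp h) (by omega)

lemma priorCount_succ (b : Fin n → Bool) (i : Fin n) (hi : i.val + 1 < n) :
    priorCount b ⟨i.val + 1, hi⟩ = priorCount b i + if b i = true then 1 else 0 := by
  unfold priorCount
  split_ifs with h
  · rw [← Finset.card_insert_of_notMem (a := i) (by simp)]
    congr 1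
    ext i'
    simp only [Finset.mem_filter, Finset.mem_univ, true_and, Finset.mem_insert, Fin.lt_def,
      Fin.ext_iff]
    constructor
    · rintro ⟨h1, h2⟩
      rcases Nat.lt_succ_iff_lt_or_eq.mp h1 with h3 | h3
      · exact Or.inr ⟨h3, h2⟩
      · exact Or.inl h3
    · rintro (h1 | ⟨h1, h2⟩)
      · have : i' = i := Fin.ext h1
        subst this
        exact ⟨by omega, h⟩
      · exact ⟨by omega, h2⟩
  · rw [add_zero]
    congr 1
    ext i'
    simp only [Finset.mem_filter, Finset.mem_univ, true_and, Fin.lt_def]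
    refine ⟨fun ⟨h1, h2⟩ => ⟨?_, h2⟩, fun ⟨h1, h2⟩ => ⟨by omega, h2⟩⟩
    rcases Nat.lt_succ_iff_lt_or_eq.mp h1 with h3 | h3
    · exact h3
    · exact absurd (Fin.ext h3 ▸ h2) h

/-- The probability that `l + 1` of the `k` slots are left when agent `i` arrives, if agents
qualify independently with probabilities `q`. -/
def slotProb (q : Fin n → ℝ) (k : ℕ) (i : Fin n) (l : ℕ) : ℝ :=
  piExpect (berWeight q) fun b => if priorCount b i + l + 1 = k then 1 else 0

/-- The probability that a slot is left when agent `i` arrives, if agents qualify independently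
with probabilities `q`. -/
def openProb (q : Fin n → ℝ) (k : ℕ) (i : Fin n) : ℝ :=
  piExpect (berWeight q) fun b => if priorCount b i < k then 1 else 0

lemma slotProb_nonneg {q : Fin n → ℝ} (h0 : ∀ i, 0 ≤ q i) (h1 : ∀ i, q i ≤ 1) (k : ℕ)
    (i : Fin n) (l : ℕ) : 0 ≤ slotProb q k i l :=
  piExpect_nonneg (berWeight_nonneg h0 h1) fun b => by split_ifs <;> norm_num

lemma openProb_nonneg {q : Fin n → ℝ} (h0 : ∀ i, 0 ≤ q i) (h1 : ∀ i, q i ≤ 1) (k : ℕ)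
    (i : Fin n) : 0 ≤ openProb q k i :=
  piExpect_nonneg (berWeight_nonneg h0 h1) fun b => by split_ifs <;> norm_num

lemma openProb_le_one {q : Fin n → ℝ} (h0 : ∀ i, 0 ≤ q i) (h1 : ∀ i, q i ≤ 1) (k : ℕ)
    (i : Fin n) : openProb q k i ≤ 1 := by
  rw [← piExpect_one (berWeight_sum q)]
  exact piExpect_mono (berWeight_nonneg h0 h1) fun b => by split_ifs <;> norm_num

lemma sum_slotProb (q : Fin n → ℝ) (k : ℕ) (i : Fin n) :
    ∑ l : Fin k, slotProb q k i l = openProb q k i := by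
  unfold slotProb openProb
  rw [← piExpect_sum]
  congr 1
  funext b
  split_ifs with h
  · rw [Finset.sum_eq_single (⟨k - 1 - priorCount b i, by omega⟩ : Fin k)]
    · rw [if_pos (by simp only; omega)]
    · intro l _ hl
      rw [if_neg]
      intro h'
      exact hl (Fin.ext (by simp only; omega))
    · simp
  · exact Finset.sum_eq_zero fun l _ => if_neg (by omega)

lemma slotProb_zero (q : Fin n → ℝ) (k : ℕ) {i : Fin n} (hi : i.val = 0) (l : ℕ) :
    slotProb q k i l = if l + 1 = k then 1 else 0 := by
  unfold slotProb
  simp only [priorCount_zero _ hi, zero_add]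
  split_ifs with h
  · exact piExpect_one (berWeight_sum q)
  · simp [piExpect]

lemma slotProb_of_le (q : Fin n → ℝ) {k : ℕ} (i : Fin n) {l : ℕ} (hl : k ≤ l) :
    slotProb q k i l = 0 :=
  Finset.sum_eq_zero fun b _ => by
    beta_reduce
    rw [if_neg (by omega), mul_zero]

/-- Condition on whether agent `i` qualifies, which is independent of the number of earlier
qualifiers. -/
lemma slotProb_succ (q : Fin n → ℝ) (k : ℕ) (i : Fin n) (hi : i.val + 1 < n) (l : ℕ) :
    slotProb q k ⟨i.val + 1, hi⟩ l =
      slotProb q k i l - q i * slotProb q k i l + q i * slotProb q k i (l + 1) := by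
  have hsplit : slotProb q k ⟨i.val + 1, hi⟩ l =
      piExpect (berWeight q) (fun b => (if b i = true then 0 else 1) *
        (if priorCount b i + l + 1 = k then 1 else 0)) +
      piExpect (berWeight q) (fun b => (if b i = true then 1 else 0) *
        (if priorCount b i + (l + 1) + 1 = k then 1 else 0)) := by
    rw [← piExpect_add]
    unfold slotProb
    congr 1
    funext b
    rw [priorCount_succ]
    by_cases hb : b i = true
    · simp only [hb, if_true, zero_mul, one_mul, zero_add]
      congr 1
      exact propext ⟨fun h => by omega, fun h => by omega⟩
    · simp [hb]
  rw [hsplit,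
    piExpect_mul_of_indep i (berWeight_sum q i) (fun b => if b = true then 0 else 1) _
      (fun t t' h => by rw [priorCount_congr h]),
    piExpect_mul_of_indep i (berWeight_sum q i) (fun b => if b = true then 1 else 0) _
      (fun t t' h => by rw [priorCount_congr h])]
  simp only [Fintype.sum_bool, berWeight, slotProb]
  simp
  ring

lemma statePolytope_slotProb {q : Fin n → ℝ} (h0 : ∀ i, 0 ≤ q i) (h1 : ∀ i, q i ≤ 1) (k : ℕ) :
    StatePolytope (fun i (l : Fin k) => slotProb q k i l)
      (fun i (l : Fin k) => q i * slotProb q k i l) where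
  y_le i l := mul_le_of_le_one_left (slotProb_nonneg h0 h1 k i l) (h1 i)
  init i l hi := slotProb_zero q k hi l
  step i hi l := by
    rw [slotProb_succ]
    congr 1
    split_ifs with hl
    · rfl
    · rw [slotProb_of_le q i (by omega), mul_zero]
  y_nonneg i l := mul_nonneg (h0 i) (slotProb_nonneg h0 h1 k i l)

/-- Once `y = q * x`, the initial condition and the recursion determine `x`. The convention that `y`
is `0` at `k + 1` slots matches the vanishing of `slotProb` for `l ≥ k`. -/
lemma StatePolytope.eq_slotProb {k : ℕ} {x y : Fin n → Fin k → ℝ} (h : StatePolytope x y)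
    {q : Fin n → ℝ} (hxy : ∀ i l, y i l = q i * x i l) (i : Fin n) (l : Fin k) :
    x i l = slotProb q k i l := by
  obtain ⟨i, hi⟩ := i
  induction i generalizing l with
  | zero => rw [h.init _ _ rfl, slotProb_zero q k rfl]
  | succ i ih =>
    have hi' : i < n := by omega
    rw [h.step ⟨i, hi'⟩ hi l, slotProb_succ q k ⟨i, hi'⟩ hi, hxy, ih _ hi']
    congr 1
    split_ifs with hl
    · rw [hxy, ih _ hi']
    · rw [slotProb_of_le q _ (by omega), mul_zero]

end Bernoulli

/-! ### Qualification probabilities and accepted counts. -/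

namespace TypeDist

variable {n : ℕ} (D : TypeDist n)

lemma G_nonneg (i : Fin n) (j : ℕ) : 0 ≤ D.G i j :=
  Finset.sum_nonneg fun j' _ => D.p_nonneg i j'

lemma G_le_one (i : Fin n) (j : ℕ) : D.G i j ≤ 1 := by
  rw [← D.p_sum i]
  exact Finset.sum_le_sum_of_subset_of_nonneg (Finset.filter_subset _ _)
    fun j' _ _ => D.p_nonneg i j'

lemma G_mono (i : Fin n) : Monotone (D.G i) := fun _ _ h =>
  Finset.sum_le_sum_of_subset_of_nonneg
    (Finset.monotone_filter_right _ fun _ _ hlt => hlt.trans_le h) fun j' _ _ => D.p_nonneg i j'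

lemma G_zero (i : Fin n) : D.G i 0 = 0 := by simp [G]

lemma G_m (i : Fin n) : D.G i D.m = 1 := by
  simp [G, D.p_sum]

lemma G_succ (i : Fin n) (j : Fin D.m) : D.G i (j + 1) = D.G i j + D.p i j := by
  have : (Finset.univ.filter fun j' : Fin D.m => j'.val < j + 1) =
      insert j (Finset.univ.filter fun j' : Fin D.m => j'.val < j) := by
    ext j'
    simp only [Finset.mem_filter, Finset.mem_univ, true_and, Finset.mem_insert, Fin.ext_iff]
    omega
  rw [G, this, Finset.sum_insert (by simp), add_comm]
  rfl

lemma G_succ_eq_sum (i : Fin n) (j : Fin D.m) :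
    D.G i (j + 1) = ∑ j', D.p i j' * if j' ≤ j then 1 else 0 := by
  simp only [G, Finset.sum_filter, mul_ite, mul_one, mul_zero, Nat.lt_succ_iff, Fin.le_def]

lemma m_pos (hn : 0 < n) : 0 < D.m := by
  rcases Nat.eq_zero_or_pos D.m with h | h
  · have h1 := D.G_m ⟨0, hn⟩
    rw [h, G_zero] at h1
    exact absurd h1 zero_ne_one
  · exact h

/-- The probability that agent `i` qualifies for the static threshold `a`. -/
def qualProb (a : D.Threshold) (i : Fin n) : ℝ :=
  (1 - (a.2 : ℝ)) * D.G i a.1 + (a.2 : ℝ) * D.G i (a.1 + 1)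

variable {D}

lemma qualProb_eq_sum (a : D.Threshold) (i : Fin n) :
    D.qualProb a i = ∑ j, D.p i j * if j < a.1 then 1 else if j = a.1 then (a.2 : ℝ) else 0 := by
  have h : ∀ j, (D.p i j * if j < a.1 then 1 else if j = a.1 then (a.2 : ℝ) else 0) =
      (if j < a.1 then D.p i j else 0) + (if j = a.1 then (a.2 : ℝ) * D.p i j else 0) := by
    intro j
    rcases lt_trichotomy j a.1 with h | h | h
    · simp [h, h.ne]
    · simp [h, mul_comm]
    · simp [h.not_gt, h.ne']
  rw [Finset.sum_congr rfl fun j _ => h j, Finset.sum_add_distrib,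
    Finset.sum_ite_eq' Finset.univ a.1]
  simp only [Finset.mem_univ, if_true, ← Finset.sum_filter]
  have : ∑ j with j < a.1, D.p i j = D.G i a.1 := rfl
  rw [this, qualProb, G_succ]
  ring

lemma qualProb_nonneg (a : D.Threshold) (i : Fin n) : 0 ≤ D.qualProb a i :=
  add_nonneg (mul_nonneg (sub_nonneg.2 a.2.2.2) (D.G_nonneg _ _))
    (mul_nonneg a.2.2.1.le (D.G_nonneg _ _))

lemma qualProb_le_one (a : D.Threshold) (i : Fin n) : D.qualProb a i ≤ 1 := by
  have h1 := mul_le_mul_of_nonneg_left (D.G_le_one i a.1) (sub_nonneg.2 a.2.2.2)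
  have h2 := mul_le_mul_of_nonneg_left (D.G_le_one i (a.1 + 1)) a.2.2.1.le
  unfold qualProb
  linarith

/-- The events "agent `i` qualifies" and "its type is at most `j`" are nested, in a direction
depending on whether `j < a.1`. Their intersection is the smaller event, which is the source of the
minimum in the LP. -/
lemma sum_qualifies_eq_min (a : D.Threshold) (i : Fin n) (j : Fin D.m) :
    ∑ j', D.p i j' * ((if j' < a.1 then 1 else if j' = a.1 then (a.2 : ℝ) else 0) *
      if j' ≤ j then 1 else 0) = min (D.qualProb a i) (D.G i (j + 1)) := by
  have h0 := a.2.2.1.le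
  have h1 := a.2.2.2
  rcases lt_or_ge j a.1 with h | h
  · rw [min_eq_right]
    · rw [G_succ_eq_sum]
      refine Finset.sum_congr rfl fun j' _ => ?_
      by_cases hj : j' ≤ j
      · simp [hj, hj.trans_lt h]
      · simp [hj]
    · rw [qualProb_eq_sum, G_succ_eq_sum]
      refine Finset.sum_le_sum fun j' _ => mul_le_mul_of_nonneg_left ?_ (D.p_nonneg _ _)
      by_cases hj : j' ≤ j
      · simp [hj, hj.trans_lt h]
      · rw [if_neg hj]
        split_ifs <;> simp [h0]
  · rw [min_eq_left]
    · rw [qualProb_eq_sum]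
      refine Finset.sum_congr rfl fun j' _ => ?_
      by_cases hj : j' ≤ j
      · simp [hj]
      · have hj' : a.1 < j' := h.trans_lt (not_le.1 hj)
        simp [hj, hj'.not_gt, hj'.ne']
    · rw [qualProb_eq_sum, G_succ_eq_sum]
      refine Finset.sum_le_sum fun j' _ => mul_le_mul_of_nonneg_left ?_ (D.p_nonneg _ _)
      by_cases hj : j' ≤ j
      · rw [if_pos hj]
        split_ifs <;> simp [h1]
      · have hj' : a.1 < j' := h.trans_lt (not_le.1 hj)
        simp [hj, hj'.not_gt, hj'.ne']

variable (D)

/-- The expected number of agents of type `j` or better accepted by the static threshold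
policy `a`. -/
def accepted (k : ℕ) (j : Fin D.m) (a : D.Threshold) : ℝ :=
  ∑ i, min (D.qualProb a i) (D.G i (j + 1)) * openProb (D.qualProb a) k i

variable {D}

lemma accepted_nonneg (k : ℕ) (j : Fin D.m) (a : D.Threshold) : 0 ≤ D.accepted k j a :=
  Finset.sum_nonneg fun i _ => mul_nonneg (le_min (qualProb_nonneg a i) (D.G_nonneg _ _))
    (openProb_nonneg (qualProb_nonneg a) (qualProb_le_one a) k i)

lemma accepted_le (k : ℕ) (j : Fin D.m) (a : D.Threshold) : D.accepted k j a ≤ n := by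
  have h : ∀ i ∈ Finset.univ,
      min (D.qualProb a i) (D.G i (j + 1)) * openProb (D.qualProb a) k i ≤ 1 := fun i _ =>
    mul_le_one₀ ((min_le_left _ _).trans (qualProb_le_one a i))
      (openProb_nonneg (qualProb_nonneg a) (qualProb_le_one a) k i)
      (openProb_le_one (qualProb_nonneg a) (qualProb_le_one a) k i)
  exact (Finset.sum_le_card_nsmul _ _ _ h).trans_eq (by simp)

lemma measurable_qualProb (i : Fin n) : Measurable fun a : D.Threshold => D.qualProb a i := by
  have h1 : Measurable fun a : D.Threshold => D.G i a.1 :=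
    (measurable_of_finite fun j : Fin D.m => D.G i j).comp measurable_fst
  have h2 : Measurable fun a : D.Threshold => D.G i (a.1 + 1) :=
    (measurable_of_finite fun j : Fin D.m => D.G i (j + 1)).comp measurable_fst
  have h3 : Measurable fun a : D.Threshold => (a.2 : ℝ) :=
    measurable_subtype_coe.comp measurable_snd
  exact ((measurable_const.sub h3).mul h1).add (h3.mul h2)

lemma measurable_accepted (k : ℕ) (j : Fin D.m) : Measurable (D.accepted k j) := by
  refine Finset.measurable_sum _ fun i _ => ((measurable_qualProb i).min measurable_const).mul ?_
  refine Finset.measurable_sum _ fun b _ => Measurable.mul_const ?_ _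
  refine Finset.measurable_prod _ fun i' _ => ?_
  simp only [berWeight]
  split_ifs
  · exact measurable_qualProb i'
  · exact measurable_const.sub (measurable_qualProb i')

lemma integrable_accepted (k : ℕ) (j : Fin D.m) (μ : MeasureTheory.Measure D.Threshold)
    [MeasureTheory.IsFiniteMeasure μ] : MeasureTheory.Integrable (D.accepted k j) μ :=
  MeasureTheory.Integrable.of_bound (measurable_accepted k j).aestronglyMeasurable n
    (Filter.Eventually.of_forall fun a => by
      rw [Real.norm_of_nonneg (accepted_nonneg k j a)]
      exact accepted_le k j a)

end TypeDist

/-! ### Eliminating the state variables from the LP. -/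

lemma DualFeasible.sum_min_eq_accepted {n k : ℕ} {D : TypeDist n} {Q : Fin D.m → ℝ} {θ : ℝ}
    {μ : MeasureTheory.Measure D.Threshold} {x y : D.Threshold → Fin n → Fin k → ℝ}
    (h : DualFeasible k D Q θ μ x y) (j : Fin D.m) (a : D.Threshold) :
    ∑ i, ∑ l, min (y a i l) (D.G i (j + 1) * x a i l) = D.accepted k j a := by
  refine Finset.sum_congr rfl fun i _ => ?_
  rw [← sum_slotProb, Finset.mul_sum]
  refine Finset.sum_congr rfl fun l _ => ?_
  have hx := (h.state a).eq_slotProb (q := D.qualProb a) (h.rule a) i l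
  rw [h.rule a i l, min_mul_of_nonneg, hx]
  · rfl
  · exact slotProb_nonneg (TypeDist.qualProb_nonneg a) (TypeDist.qualProb_le_one a) k i l

lemma DualFeasible.cover_accepted {n k : ℕ} {D : TypeDist n} {Q : Fin D.m → ℝ} {θ : ℝ}
    {μ : MeasureTheory.Measure D.Threshold} {x y : D.Threshold → Fin n → Fin k → ℝ}
    (h : DualFeasible k D Q θ μ x y) (j : Fin D.m) :
    θ * Q j ≤ ∫ a, D.accepted k j a ∂μ := by
  simpa only [h.sum_min_eq_accepted j] using h.cover j

lemma dualFeasible_of_cover {n k : ℕ} {D : TypeDist n} {Q : Fin D.m → ℝ} {θ : ℝ}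
    {μ : MeasureTheory.Measure D.Threshold} (hμ : MeasureTheory.IsProbabilityMeasure μ)
    (h : ∀ j, θ * Q j ≤ ∫ a, D.accepted k j a ∂μ) :
    DualFeasible k D Q θ μ (fun a i l => slotProb (D.qualProb a) k i l)
      (fun a i l => D.qualProb a i * slotProb (D.qualProb a) k i l) where
  cover j := by
    refine (h j).trans_eq (MeasureTheory.integral_congr_ae (Filter.Eventually.of_forall fun a => ?_))
    refine Finset.sum_congr rfl fun i _ => ?_
    rw [← sum_slotProb, Finset.mul_sum]
    exact Finset.sum_congr rfl fun l _ => min_mul_of_nonneg _ _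
      (slotProb_nonneg (TypeDist.qualProb_nonneg a) (TypeDist.qualProb_le_one a) k i l)
  rule a i l := rfl
  state a := statePolytope_slotProb (TypeDist.qualProb_nonneg a) (TypeDist.qualProb_le_one a) k
  prob := hμ

/-! ### Valuations as tail sums, and optimal subsets. -/

lemma exists_tail_sum {m : ℕ} {r : Fin m → ℝ} (hr : Antitone r) (h0 : ∀ j, 0 ≤ r j) :
    ∃ δ : Fin m → ℝ, (∀ j, 0 ≤ δ j) ∧ ∀ j, r j = ∑ j', if j ≤ j' then δ j' else 0 := by
  induction m with
  | zero => exact ⟨0, fun j => j.elim0, fun j => j.elim0⟩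
  | succ m ih =>
    -- Subtracting the lowest valuation leaves a shorter nonincreasing nonnegative sequence; that
    -- valuation is the last increment.
    obtain ⟨δ, hδ, hrδ⟩ := ih (r := fun j => r j.castSucc - r (Fin.last m))
      (fun j j' h => sub_le_sub_right (hr (Fin.castSucc_le_castSucc_iff.2 h)) _)
      (fun j => sub_nonneg.2 (hr (Fin.le_last _)))
    refine ⟨Fin.snoc δ (r (Fin.last m)), fun j => ?_, fun j => ?_⟩
    · refine Fin.lastCases ?_ (fun j => ?_) j
      · simpa using h0 _
      · simpa using hδ j
    · rw [Fin.sum_univ_castSucc]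
      refine Fin.lastCases ?_ (fun j => ?_) j
      · simp only [Fin.snoc_last, le_refl, if_true]
        rw [Finset.sum_eq_zero fun j _ => if_neg (not_le.2 (Fin.castSucc_lt_last j)), zero_add]
      · simp only [Fin.snoc_last, Fin.snoc_castSucc, Fin.castSucc_le_castSucc_iff,
          Fin.le_last, if_true]
        rw [← hrδ j]
        ring

lemma antitone_tail_sum {m : ℕ} {δ : Fin m → ℝ} (hδ : ∀ j, 0 ≤ δ j) :
    Antitone fun j : Fin m => ∑ j', if j ≤ j' then δ j' else 0 := fun j₁ j₂ h =>
  Finset.sum_le_sum fun j' _ => by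
    split_ifs with h2 h1
    · exact le_rfl
    · exact absurd (h.trans h2) h1
    · exact hδ j'
    · exact le_rfl

lemma sum_mul_tail_sum {ι : Type*} {m : ℕ} (s : Finset ι) (w : ι → ℝ) (t : ι → Fin m)
    (δ : Fin m → ℝ) :
    ∑ i ∈ s, w i * (∑ j, if t i ≤ j then δ j else 0) =
      ∑ j, δ j * ∑ i ∈ s, w i * if t i ≤ j then 1 else 0 := by
  simp only [Finset.mul_sum]
  rw [Finset.sum_comm]
  refine Finset.sum_congr rfl fun j _ => Finset.sum_congr rfl fun i _ => ?_
  split_ifs <;> ring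

lemma exists_best_subset {n m k : ℕ} (hk : k ≤ n) (t : Fin n → Fin m) :
    ∃ S : Finset (Fin n), S.card = k ∧ ∀ i ∈ S, ∀ i' ∉ S, t i ≤ t i' := by
  induction k with
  | zero => exact ⟨∅, by simp⟩
  | succ k ih =>
    obtain ⟨S, hS, hbest⟩ := ih (by omega)
    have hne : Sᶜ.Nonempty := by
      rw [← Finset.card_pos, Finset.card_compl, Fintype.card_fin]
      omega
    obtain ⟨i₀, hi₀, hmin⟩ := Finset.exists_min_image Sᶜ t hne
    rw [Finset.mem_compl] at hi₀
    refine ⟨insert i₀ S, by rw [Finset.card_insert_of_notMem hi₀, hS], fun i hi i' hi' => ?_⟩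
    rw [Finset.mem_insert, not_or] at hi'
    rcases Finset.mem_insert.1 hi with rfl | hi
    · exact hmin i' (Finset.mem_compl.2 hi'.2)
    · exact hbest i hi i' hi'.2

/-- Each level `j` bounds its own term separately, and one set, the `k` agents of best types,
attains all these bounds at once. -/
lemma sup_sum_tail_sum {n m k : ℕ} (hk : k ≤ n) {δ : Fin m → ℝ} (hδ : ∀ j, 0 ≤ δ j)
    (t : Fin n → Fin m) :
    (Finset.univ.filter fun S : Finset (Fin n) => S.card ≤ k).sup' ⟨∅, by simp⟩
      (fun S => ∑ i ∈ S, ∑ j, if t i ≤ j then δ j else 0) =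
      ∑ j, δ j * min ((Finset.univ.filter fun i => t i ≤ j).card : ℝ) (k : ℝ) := by
  have hsum : ∀ S : Finset (Fin n), ∑ i ∈ S, (∑ j, if t i ≤ j then δ j else 0) =
      ∑ j, δ j * ((S.filter fun i => t i ≤ j).card : ℝ) := by
    intro S
    have := sum_mul_tail_sum S (fun _ => 1) t δ
    simp only [one_mul] at this
    rw [this]
    exact Finset.sum_congr rfl fun j _ => by rw [Finset.sum_boole]
  apply le_antisymm
  · refine Finset.sup'_le _ _ fun S hS => ?_
    have hS' : S.card ≤ k := by simpa using hS
    rw [hsum]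
    refine Finset.sum_le_sum fun j _ => mul_le_mul_of_nonneg_left (le_min ?_ ?_) (hδ j)
    · exact_mod_cast Finset.card_le_card (Finset.filter_subset_filter _ (Finset.subset_univ S))
    · exact_mod_cast (Finset.card_filter_le _ _).trans hS'
  · obtain ⟨S, hS, hbest⟩ := exists_best_subset hk t
    refine le_trans (le_of_eq ?_) (Finset.le_sup' _ (b := S) (by simp [hS.le]))
    rw [hsum]
    refine Finset.sum_congr rfl fun j _ => ?_
    congr 1
    by_cases hall : ∀ i ∈ S, t i ≤ j
    · rw [Finset.filter_true_of_mem hall, hS, min_eq_right]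
      rw [← hS]
      exact_mod_cast Finset.card_le_card fun i hi => by simpa using hall i hi
    · push Not at hall
      obtain ⟨i, hi, hij⟩ := hall
      -- If `S` contains an agent worse than `j`, then by its choice it already contains every agent
      -- of type at most `j`.
      have : (Finset.univ.filter fun i => t i ≤ j) = S.filter fun i => t i ≤ j := by
        ext i'
        simp only [Finset.mem_filter, Finset.mem_univ, true_and]
        refine ⟨fun h => ⟨?_, h⟩, fun h => h.2⟩
        by_contra hi'
        exact absurd ((hbest i hi i' hi').trans h) (not_le.2 hij)
      rw [this, min_eq_left]
      rw [← hS]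
      exact_mod_cast Finset.card_filter_le _ _

/-! ### The benchmark coefficients. -/

namespace TypeDist

variable {n : ℕ} (D : TypeDist n)

lemma expect_eq_piExpect (f : (Fin n → Fin D.m) → ℝ) : D.expect f = piExpect D.p f := rfl

lemma prophQ_eq_expect (k : ℕ) (j : Fin D.m) :
    D.prophQ k j = piExpect D.p fun t =>
      min ((Finset.univ.filter fun i => t i ≤ j).card : ℝ) (k : ℝ) := by
  have h := piExpect_map D.p (fun j' => decide (j' ≤ j))
    (fun b => min ((Finset.univ.filter fun i => b i = true).card : ℝ) (k : ℝ))
  rw [fiber_sum_eq_berWeight D.p_sum] at h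
  simp only [decide_eq_true_eq] at h
  rw [h, prophQ, berExpect_eq_piExpect]
  congr 2
  funext i
  rw [G]
  refine Finset.sum_congr ?_ fun _ _ => rfl
  ext j'
  simp only [Finset.mem_filter, Finset.mem_univ, true_and, Fin.le_def]
  omega

lemma prophQ_nonneg (k : ℕ) (j : Fin D.m) : 0 ≤ D.prophQ k j := by
  rw [prophQ_eq_expect]
  exact piExpect_nonneg D.p_nonneg fun _ =>
    le_min (Nat.cast_nonneg _) (Nat.cast_nonneg _)

lemma exAnteQ_nonneg (k : ℕ) (j : Fin D.m) : 0 ≤ D.exAnteQ k j :=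
  le_min (Finset.sum_nonneg fun i _ => D.G_nonneg i _) (Nat.cast_nonneg k)

end TypeDist

lemma sum_telescope_le {m : ℕ} (M : ℕ → ℝ) (j : Fin m) :
    ∑ j' : Fin m, (M (j' + 1) - M j') * (if j' ≤ j then 1 else 0) = M (j + 1) - M 0 := by
  simp only [Fin.le_def]
  rw [Fin.sum_univ_eq_sum_range fun j' => (M (j' + 1) - M j') * (if j' ≤ j.val then 1 else 0)]
  simp only [mul_ite, mul_one, mul_zero]
  rw [← Finset.sum_filter, ← Finset.sum_range_sub]
  refine Finset.sum_congr ?_ fun _ _ => rfl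
  ext j'
  have := j.2
  simp only [Finset.mem_filter, Finset.mem_range]
  omega

/-! ### Linearity of benchmarks and policy values in the increments. -/

namespace ProphetInstance

variable {n k : ℕ} {I : ProphetInstance n} {δ : Fin I.m → ℝ}

lemma proph_eq (hk : k ≤ n) (hδ : ∀ j, 0 ≤ δ j)
    (hr : ∀ j, I.r j = ∑ j', if j ≤ j' then δ j' else 0) :
    I.proph k = ∑ j, δ j * I.prophQ k j := by
  simp only [proph, hr, sup_sum_tail_sum hk hδ, TypeDist.expect_eq_piExpect, piExpect_sum,
    piExpect_const_mul, TypeDist.prophQ_eq_expect]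

lemma exAnte_eq (hδ : ∀ j, 0 ≤ δ j)
    (hr : ∀ j, I.r j = ∑ j', if j ≤ j' then δ j' else 0) :
    I.exAnte k = ∑ j, δ j * I.exAnteQ k j := by
  have hval : ∀ a : Fin I.m → ℝ, ∑ j, I.r j * a j =
      ∑ j, δ j * ∑ j', a j' * if j' ≤ j then 1 else 0 := by
    intro a
    rw [← sum_mul_tail_sum Finset.univ a (fun j => j) δ]
    exact Finset.sum_congr rfl fun j _ => by rw [hr, mul_comm]
  have hGsum : ∀ j : Fin I.m, ∑ i, I.G i (j + 1) = ∑ j', (∑ i, I.p i j') * if j' ≤ j then 1 else 0 := by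
    intro j
    simp only [TypeDist.G_succ_eq_sum, Finset.sum_mul]
    exact Finset.sum_comm
  apply IsGreatest.csSup_eq
  constructor
  -- The greedy solution fills the capacity from the best type on. Its partial sums are `M`, so it
  -- meets the bound of every level simultaneously.
  · set M : ℕ → ℝ := fun j => min (∑ i, I.G i j) (k : ℝ) with hM
    have hM0 : M 0 = 0 := by simp [hM, TypeDist.G_zero]
    refine ⟨fun j => M (j + 1) - M j, ?_, fun j => ⟨?_, ?_⟩, ?_⟩
    · rw [Fin.sum_univ_eq_sum_range fun j => M (j + 1) - M j, Finset.sum_range_sub, hM0, sub_zero]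
      exact min_le_right _ _
    · exact sub_nonneg.2 (min_le_min_right _
        (Finset.sum_le_sum fun i _ => I.G_mono i (Nat.le_succ _)))
    · have hp : 0 ≤ ∑ i, I.p i j := Finset.sum_nonneg fun i _ => I.p_nonneg i j
      simp only [hM, TypeDist.G_succ, Finset.sum_add_distrib]
      rw [sub_le_iff_le_add', ← min_add_add_right]
      exact min_le_min_left _ (le_add_of_nonneg_right hp)
    · rw [hval]
      refine Finset.sum_congr rfl fun j _ => ?_
      rw [sum_telescope_le, hM0, sub_zero]
      rfl
  · rintro v ⟨a, hak, ha, rfl⟩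
    rw [hval]
    refine Finset.sum_le_sum fun j _ => mul_le_mul_of_nonneg_left (le_min ?_ ?_) (hδ j)
    · rw [hGsum]
      exact Finset.sum_le_sum fun j' _ =>
        mul_le_mul_of_nonneg_right (ha j').2 (by split_ifs <;> norm_num)
    · refine le_trans (Finset.sum_le_sum fun j' _ => ?_) hak
      exact mul_le_of_le_one_right (ha j').1 (by split_ifs <;> norm_num)

/-- Merge each agent's type and coin into one coordinate. Its own qualification and value are then
independent of whether a slot is left. -/
lemma policyValue_eq (hr : ∀ j, I.r j = ∑ j', if j ≤ j' then δ j' else 0) (a : I.Threshold) :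
    I.policyValue k a = ∑ j, δ j * I.accepted k j a := by
  classical
  set W : Fin n → Fin I.m × Bool → ℝ :=
    fun i z => I.p i z.1 * berWeight (fun _ : Fin n => (a.2 : ℝ)) i z.2 with hW
  set g : Fin I.m × Bool → Bool := fun z => decide (z.1 < a.1 ∨ (z.1 = a.1 ∧ z.2 = true)) with hg
  have hmarg : ∀ i (h : Fin I.m → ℝ), ∑ z, W i z * (if g z = true then h z.1 else 0) =
      ∑ j, I.p i j * ((if j < a.1 then 1 else if j = a.1 then (a.2 : ℝ) else 0) * h j) := by
    intro i h
    rw [Fintype.sum_prod_type]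
    refine Finset.sum_congr rfl fun j _ => ?_
    rcases lt_trichotomy j a.1 with hj | hj | hj
    · simp [hW, hg, berWeight, hj]
      ring
    · simp [hW, hg, berWeight, hj]
      ring
    · simp [hW, hg, hj.not_gt, hj.ne']
  have hWsum : ∀ i, ∑ z, W i z = 1 := by
    intro i
    simp only [hW, Fintype.sum_prod_type, ← Finset.mul_sum, berWeight_sum, mul_one, I.p_sum]
  have hqual : (fun i => ∑ z with g z = true, W i z) = I.qualProb a := by
    funext i
    rw [Finset.sum_filter, TypeDist.qualProb_eq_sum]
    simpa using hmarg i fun _ => 1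
  have hopen : ∀ i, piExpect W (fun z => if priorCount (fun i => g (z i)) i < k then 1 else 0) =
      openProb (I.qualProb a) k i := by
    intro i
    rw [piExpect_map W g fun b => if priorCount b i < k then (1 : ℝ) else 0,
      fiber_sum_eq_berWeight hWsum, hqual]
    rfl
  have hpol : I.policyValue k a = ∑ i, piExpect W fun z =>
      (if g (z i) = true then I.r (z i).1 else 0) *
        if priorCount (fun i => g (z i)) i < k then 1 else 0 := by
    rw [← piExpect_sum, policyValue, TypeDist.expect_eq_piExpect]
    simp only [berExpect_eq_piExpect]
    rw [piExpect_pair]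
    congr 1
    funext z
    refine Finset.sum_congr rfl fun i _ => ?_
    simp only [hg, priorCount, decide_eq_true_eq, mul_ite, mul_one, mul_zero]
    rw [← ite_and]
    exact if_congr and_comm rfl rfl
  rw [hpol]
  have hagent : ∀ i, (piExpect W fun z => (if g (z i) = true then I.r (z i).1 else 0) *
        if priorCount (fun i => g (z i)) i < k then 1 else 0) =
      ∑ j, δ j * (min (I.qualProb a i) (I.G i (j + 1)) * openProb (I.qualProb a) k i) := by
    intro i
    rw [piExpect_mul_of_indep i (hWsum i) (fun z => if g z = true then I.r z.1 else 0) _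
      (fun t t' h => by
        rw [priorCount_congr (b' := fun i => g (t' i)) fun i' hi' => by rw [h i' hi']]),
      hmarg i I.r, hopen]
    simp only [hr, ← mul_assoc]
    rw [sum_mul_tail_sum Finset.univ _ (fun j => j) δ, Finset.sum_mul]
    refine Finset.sum_congr rfl fun j _ => ?_
    rw [← TypeDist.sum_qualifies_eq_min]
    simp only [mul_assoc]
  rw [Finset.sum_congr rfl fun i _ => hagent i, Finset.sum_comm]
  exact Finset.sum_congr rfl fun j _ => (Finset.mul_sum _ _ _).symm

end ProphetInstance

/-! ### Minimax duality between valuations and mixed thresholds. -/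

section Duality

variable {n k : ℕ}

lemma bddAbove_sum_accepted {D : TypeDist n} {δ : Fin D.m → ℝ} (hδ : ∀ j, 0 ≤ δ j) :
    BddAbove (Set.range fun a : D.Threshold => ∑ j, δ j * D.accepted k j a) := by
  refine ⟨∑ j, δ j * n, ?_⟩
  rintro _ ⟨a, rfl⟩
  exact Finset.sum_le_sum fun j _ =>
    mul_le_mul_of_nonneg_left (TypeDist.accepted_le k j a) (hδ j)

lemma DualFeasible.mul_le_iSup {D : TypeDist n} {Q : Fin D.m → ℝ} {θ : ℝ}
    {μ : MeasureTheory.Measure D.Threshold} {x y : D.Threshold → Fin n → Fin k → ℝ}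
    (h : DualFeasible k D Q θ μ x y) {δ : Fin D.m → ℝ} (hδ : ∀ j, 0 ≤ δ j) :
    θ * ∑ j, δ j * Q j ≤ ⨆ a : D.Threshold, ∑ j, δ j * D.accepted k j a := by
  have := h.prob
  have hint : ∀ j ∈ Finset.univ,
      MeasureTheory.Integrable (fun a => δ j * D.accepted k j a) μ := fun j _ =>
    (TypeDist.integrable_accepted k j μ).const_mul (δ j)
  calc θ * ∑ j, δ j * Q j = ∑ j, δ j * (θ * Q j) := by
        rw [Finset.mul_sum]
        exact Finset.sum_congr rfl fun j _ => by ring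
    _ ≤ ∑ j, δ j * ∫ a, D.accepted k j a ∂μ :=
        Finset.sum_le_sum fun j _ => mul_le_mul_of_nonneg_left (h.cover_accepted j) (hδ j)
    _ = ∫ a, ∑ j, δ j * D.accepted k j a ∂μ := by
        rw [MeasureTheory.integral_finsetSum _ hint]
        simp only [MeasureTheory.integral_const_mul]
    _ ≤ ∫ _, (⨆ a : D.Threshold, ∑ j, δ j * D.accepted k j a) ∂μ :=
        MeasureTheory.integral_mono (MeasureTheory.integrable_finsetSum _ hint)
          (MeasureTheory.integrable_const _) fun a => le_ciSup (bddAbove_sum_accepted hδ) a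
    _ = _ := by simp

/-- The vectors of expected numbers of accepted agents that randomized static threshold
policies dominate. -/
def dominatedSet (k : ℕ) (D : TypeDist n) : Set (Fin D.m → ℝ) :=
  {c | ∃ μ : MeasureTheory.Measure D.Threshold, MeasureTheory.IsProbabilityMeasure μ ∧
    ∀ j, c j ≤ ∫ a, D.accepted k j a ∂μ}

lemma convex_dominatedSet (D : TypeDist n) : Convex ℝ (dominatedSet k D) := by
  rintro c ⟨μ, hμ, hc⟩ c' ⟨μ', hμ', hc'⟩ s s' hs hs' hss
  refine ⟨ENNReal.ofReal s • μ + ENNReal.ofReal s' • μ', ⟨?_⟩, fun j => ?_⟩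
  · simp [← ENNReal.ofReal_add hs hs', hss]
  · rw [MeasureTheory.integral_add_measure
      ((TypeDist.integrable_accepted k j μ).smul_measure ENNReal.ofReal_ne_top)
      ((TypeDist.integrable_accepted k j μ').smul_measure ENNReal.ofReal_ne_top),
      MeasureTheory.integral_smul_measure, MeasureTheory.integral_smul_measure,
      ENNReal.toReal_ofReal hs, ENNReal.toReal_ofReal hs']
    exact add_le_add (mul_le_mul_of_nonneg_left (hc j) hs) (mul_le_mul_of_nonneg_left (hc' j) hs')

lemma mem_dominatedSet_of_le {D : TypeDist n} {c : Fin D.m → ℝ} (a : D.Threshold)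
    (h : ∀ j, c j ≤ D.accepted k j a) : c ∈ dominatedSet k D :=
  ⟨MeasureTheory.Measure.dirac a, inferInstance, fun j => by
    rw [MeasureTheory.integral_dirac' _ _ (TypeDist.measurable_accepted k j).stronglyMeasurable]
    exact h j⟩

/-- A functional separating `θ • Q` from the set would have nonnegative coefficients, as the set is
downward closed. These coefficients serve as increments for which every policy falls short of `θ`
times the benchmark. -/
lemma mem_closure_dominatedSet {D : TypeDist n} [Nonempty D.Threshold] {Q : Fin D.m → ℝ} {θ : ℝ}
    (hθ : 0 < θ)
    (h : ∀ δ : Fin D.m → ℝ, (∀ j, 0 ≤ δ j) → 0 < ∑ j, δ j * Q j →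
      θ * ∑ j, δ j * Q j ≤ ⨆ a : D.Threshold, ∑ j, δ j * D.accepted k j a) :
    θ • Q ∈ closure (dominatedSet k D) := by
  classical
  by_contra hmem
  obtain ⟨f, u, hfu, hux⟩ :=
    geometric_hahn_banach_closed_point (convex_dominatedSet D).closure isClosed_closure hmem
  set δ : Fin D.m → ℝ := fun j => f (Pi.single j 1) with hδdef
  have hf : ∀ c, f c = ∑ j, δ j * c j := by
    intro c
    have := LinearMap.pi_apply_eq_sum_univ (f : (Fin D.m → ℝ) →ₗ[ℝ] ℝ) c
    simp only [ContinuousLinearMap.coe_coe, smul_eq_mul] at this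
    rw [this]
    refine Finset.sum_congr rfl fun j _ => ?_
    rw [mul_comm, hδdef]
    congr 2
    ext i
    simp [Pi.single_apply, eq_comm]
  have hδ : ∀ j, 0 ≤ δ j := by
    intro j
    by_contra! hneg
    obtain ⟨a⟩ := ‹Nonempty D.Threshold›
    set c : Fin D.m → ℝ := fun j => D.accepted k j a
    -- Lowering coordinate `j` of `c` by this amount raises `f` to `f c + |u - f c| ≥ u` without
    -- leaving the set.
    have hs : 0 ≤ |u - f c| / (-δ j) := div_nonneg (abs_nonneg _) (by linarith)
    have hlt := hfu _ (subset_closure (mem_dominatedSet_of_le (k := k)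
      (c := c - (|u - f c| / (-δ j)) • Pi.single j 1) a fun j' => by
        simp only [Pi.sub_apply, Pi.smul_apply, smul_eq_mul, c]
        refine sub_le_self _ (mul_nonneg hs ?_)
        by_cases hj : j' = j
        · subst hj; simp
        · simp [hj]))
    rw [map_sub, map_smul, smul_eq_mul] at hlt
    change f c - |u - f c| / (-δ j) * δ j < u at hlt
    have heq : |u - f c| / (-δ j) * δ j = -|u - f c| := by
      rw [div_neg, neg_mul, div_mul_cancel₀ _ hneg.ne]
    have := le_abs_self (u - f c)
    linarith
  have hpol : ∀ a, ∑ j, δ j * D.accepted k j a < u := fun a => by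
    rw [← hf]
    exact hfu _ (subset_closure (mem_dominatedSet_of_le a fun j => le_rfl))
  -- Positivity of `u` makes the benchmark of `δ` positive, as `h` demands.
  have hu : 0 < u := by
    obtain ⟨a⟩ := ‹Nonempty D.Threshold›
    exact (Finset.sum_nonneg fun j _ =>
      mul_nonneg (hδ j) (TypeDist.accepted_nonneg k j a)).trans_lt (hpol a)
  rw [map_smul, hf, smul_eq_mul] at hux
  have hpos : 0 < ∑ j, δ j * Q j := (mul_pos_iff_of_pos_left hθ).1 (hu.trans hux)
  exact absurd ((h δ hδ hpos).trans (ciSup_le fun a => (hpol a).le)) (not_le.2 hux)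

lemma exists_dualFeasible_of_lt {D : TypeDist n} {Q : Fin D.m → ℝ} (hQ : ∀ j, 0 ≤ Q j)
    {θ θ' : ℝ} (hlt : θ' < θ) (h : θ • Q ∈ closure (dominatedSet k D)) :
    ∃ μ x y, DualFeasible k D Q θ' μ x y := by
  -- Strict slack exists only where `Q j > 0`; where `Q j = 0` the covering constraint holds because
  -- `accepted` is nonnegative.
  have hopen : IsOpen {c : Fin D.m → ℝ | ∀ j, 0 < Q j → θ' * Q j < c j} := by
    simp only [Set.ofPred_forall]
    exact isOpen_iInter_of_finite fun j => isOpen_iInter_of_finite fun _ =>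
      isOpen_lt continuous_const (continuous_apply j)
  obtain ⟨c, hc, μ, hμ, hcμ⟩ := mem_closure_iff.1 h _ hopen
    fun j hj => mul_lt_mul_of_pos_right hlt hj
  refine ⟨μ, _, _, dualFeasible_of_cover hμ fun j => ?_⟩
  rcases (hQ j).eq_or_lt with hj | hj
  · rw [← hj, mul_zero]
    exact MeasureTheory.integral_nonneg fun a => TypeDist.accepted_nonneg k j a
  · exact (hc j hj).le.trans (hcμ j)

lemma innerLP_nonneg {D : TypeDist n} [Nonempty D.Threshold] (Q : Fin D.m → ℝ) :
    0 ≤ innerLP k D Q := by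
  obtain ⟨a⟩ := ‹Nonempty D.Threshold›
  refine le_sSup ⟨0, MeasureTheory.Measure.dirac a, _, _,
    dualFeasible_of_cover inferInstance fun j => ?_, rfl⟩
  rw [zero_mul]
  exact MeasureTheory.integral_nonneg fun a => TypeDist.accepted_nonneg k j a

lemma ProphetInstance.st_eq {I : ProphetInstance n} {δ : Fin I.m → ℝ}
    (hr : ∀ j, I.r j = ∑ j', if j ≤ j' then δ j' else 0) :
    I.st k = ⨆ a : I.Threshold, ∑ j, δ j * I.accepted k j a :=
  iSup_congr fun a => policyValue_eq hr a

theorem iInf_ratio_eq_iInf_innerLP (hn : 0 < n) (Q : ∀ D : TypeDist n, Fin D.m → ℝ)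
    (hQ : ∀ D j, 0 ≤ Q D j) (bench : ProphetInstance n → ℝ)
    (hbench : ∀ (I : ProphetInstance n) (δ : Fin I.m → ℝ), (∀ j, 0 ≤ δ j) →
      (∀ j, I.r j = ∑ j', if j ≤ j' then δ j' else 0) →
      bench I = ∑ j, δ j * Q I.toTypeDist j) :
    (⨅ (I : ProphetInstance n) (_ : 0 < bench I), ((I.st k / bench I : ℝ) : EReal)) =
      ⨅ D : TypeDist n, innerLP k D (Q D) := by
  apply le_antisymm
  · refine le_iInf fun D => ?_
    have : Nonempty D.Threshold := ⟨⟨⟨0, D.m_pos hn⟩, ⟨1, one_pos, le_rfl⟩⟩⟩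
    by_contra! hlt
    -- Two reals are inserted in the gap: `θ • Q` lies in the closure, and the smaller `θ'` is
    -- feasible.
    obtain ⟨θ', hθ', hlt⟩ := EReal.lt_iff_exists_real_btwn.1 hlt
    obtain ⟨θ, hθ, hlt⟩ := EReal.lt_iff_exists_real_btwn.1 hlt
    have hθ'pos : 0 < θ' := EReal.coe_pos.1 ((innerLP_nonneg (Q D)).trans_lt hθ')
    have hθlt : θ' < θ := EReal.coe_lt_coe_iff.1 hθ
    have hcl : θ • Q D ∈ closure (dominatedSet k D) := by
      refine mem_closure_dominatedSet (hθ'pos.trans hθlt) fun δ hδ hpos => ?_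
      let I : ProphetInstance n :=
        { D with
          r := fun j => ∑ j', if j ≤ j' then δ j' else 0
          r_antitone := antitone_tail_sum hδ
          r_nonneg := fun j => Finset.sum_nonneg fun j' _ => by
            split_ifs
            exacts [hδ j', le_rfl] }
      have hI : bench I = ∑ j, δ j * Q D j := hbench I δ hδ fun _ => rfl
      have hst : I.st k = ⨆ a : D.Threshold, ∑ j, δ j * D.accepted k j a :=
        ProphetInstance.st_eq (I := I) fun _ => rfl
      have hle : (θ : EReal) < ((I.st k / bench I : ℝ) : EReal) :=
        hlt.trans_le (iInf₂_le I (hI ▸ hpos))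
      rw [EReal.coe_lt_coe_iff, hI, lt_div_iff₀ hpos, hst] at hle
      exact hle.le
    obtain ⟨μ, x, y, hfeas⟩ := exists_dualFeasible_of_lt (hQ D) hθlt hcl
    have hle : (θ' : EReal) ≤ innerLP k D (Q D) := le_sSup ⟨θ', μ, x, y, hfeas, rfl⟩
    exact absurd hle (not_le.2 hθ')
  · refine le_iInf₂ fun I hI => (iInf_le _ I.toTypeDist).trans (sSup_le ?_)
    rintro _ ⟨θ, μ, x, y, hfeas, rfl⟩
    obtain ⟨δ, hδ, hr⟩ := exists_tail_sum I.r_antitone I.r_nonneg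
    rw [EReal.coe_le_coe_iff, le_div_iff₀ hI, hbench I δ hδ hr, ProphetInstance.st_eq hr]
    exact hfeas.mul_le_iSup hδ

end Duality

end StaticThreshold

end

theorem mainTheorem10 (k n : ℕ) (hk : 1 ≤ k) (hn : k < n) :
    (⨅ (I : StaticThreshold.ProphetInstance n) (_ : 0 < I.proph k),
        ((I.st k / I.proph k : ℝ) : EReal))
      = (⨅ D : StaticThreshold.TypeDist n, StaticThreshold.innerLP k D (D.prophQ k)) ∧
    (⨅ (I : StaticThreshold.ProphetInstance n) (_ : 0 < I.exAnte k),
        ((I.st k / I.exAnte k : ℝ) : EReal))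
      = (⨅ D : StaticThreshold.TypeDist n, StaticThreshold.innerLP k D (D.exAnteQ k)) :=
  ⟨StaticThreshold.iInf_ratio_eq_iInf_innerLP (by omega) (fun D => D.prophQ k)
      (fun D => D.prophQ_nonneg k) (fun I => I.proph k)
      fun _ _ hδ hr => StaticThreshold.ProphetInstance.proph_eq hn.le hδ hr,
    StaticThreshold.iInf_ratio_eq_iInf_innerLP (by omega) (fun D => D.exAnteQ k)
      (fun D => D.exAnteQ_nonneg k) (fun I => I.exAnte k)
      fun _ _ hδ hr => StaticThreshold.ProphetInstance.exAnte_eq hδ hr⟩
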